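/- Let $p$ be a prime and let $\mathcal O$ be a complete discrete valuation ring with field of fractions $K$ of characteristic $0$ and algebraically closed residue field $k$ of characteristic $p$. For a finite group $G$, a block $B$ of $\mathcal O G$ is an algebra $\mathcal O G e_B$ with $e_B$ a primitive idempotent of $Z(\mathcal O G)$, and $\operatorname{Irr}(B)$ is the set of irreducible characters $\chi$ of $G$ over $\overline K$ with $\chi(e_B)\neq 0$. Definitions. For $q=p^n$ and $\chi\in\operatorname{Irr}(B)$, let $\chi^{(q)}$ be the character obtained from $\chi$ by applying the automorphism $\omega_p\omega_{p'}\mapsto\omega_p\omega_{p'}^{\,q}$ of the field generated by all roots of unity in $\overline K$ (for $\omega_p$ a root of unity of $p$-power order, $\omega_{p'}$ one of order prime to $p$); $B^{(q)}$ is the block of $\mathcal O G$ whose irreducible characters are the $\chi^{(q)}$ with $\chi\in\operatorname{Irr}(B)$. For $g\in G$ write $g=g_pg_{p'}$ for the decomposition into commuting $p$- and $p'$-parts, and let $\zeta_G:\mathcal O G\to\mathcal O G$ be the $\mathcal O$-linear map with $\zeta_G(g)=g_p\,g_{p'}^{1/p}$, where $g_{p'}^{1/p}$ is the element of $\langle g_{p'}\rangle$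 whose $p$-th power is $g_{p'}$. For a $kG$-module $S$ let $S^{(q)}$ be the $kG$-module with the same underlying group on which $\sum_g\alpha_g^{\,q}g$ acts as $\sum_g\alpha_g g$ acts on $S$. A strong $\mathcal O$-Frobenius isomorphism of degree $n$ is an isomorphism of $\mathcal O$-algebras $\phi:B\to B^{(p^n)}$ such that (1) $\phi|_{Z(B)}=\zeta_G^{\circ n}|_{Z(B)}$, and (2) for every simple $B$-module $S$ (equivalently, every simple $kG$-module on which $e_B$ acts as the identity) the $B^{(p^n)}$-module associated to $S$ through $\phi$ is isomorphic to $S^{(p^n)}$. The strong $\mathcal O$-Frobenius number $\operatorname{SOF}(B)$ is the smallest integer $n\ge 1$ for which there is a strong $\mathcal O$-Frobenius isomorphism of degree $n$ from $B$ to $B^{(p^n)}$. Proposition. Let $G$ be a finite group, let $Z\le G$ be a central $p$-subgroup and let $B$ be a block of $\mathcal O G$. Let $\theta_Z:\mathcal O G\to\mathcal O(G/Z)$ be the natural $\mathcal O$-algebra homomorphism. Then $B_Z=\theta_Z(B)$ is a block of $\mathcal O(G/Z)$, with block idempotent $\theta_Z(e_B)$, and $$\operatorname{SOF}(B_Z)\le\operatorname{SOF}(B).$$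 -/

import Mathlib

open scoped MonoidAlgebra

noncomputable section

namespace FrobeniusNumber

universe u v

section GroupElements

variable {G : Type v} [Group G]

/-- The `p`-part `g_p` of a group element `g` of finite order: the power of `g` with exponent
congruent to `1` modulo the `p`-part of the order of `g` and to `0` modulo its `p'`-part. -/
def pPart (p : ℕ) (g : G) : G :=
  g ^ (ordCompl[p] (orderOf g) *
    ((ordCompl[p] (orderOf g) : ZMod (ordProj[p] (orderOf g)))⁻¹).val)

/-- The `p'`-part `g_{p'}` of a group element `g` of finite order: the power of `g` with exponent
congruent to `0` modulo the `p`-part of the order of `g` and to `1` modulo its `p'`-part. -/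
def pPrimePart (p : ℕ) (g : G) : G :=
  g ^ (ordProj[p] (orderOf g) *
    ((ordProj[p] (orderOf g) : ZMod (ordCompl[p] (orderOf g)))⁻¹).val)

/-- For `h` of finite order prime to `p`, the element `h ^ (1 / p)` of the cyclic group generated
by `h`, that is, the unique power of `h` whose `p`-th power is `h`. -/
def pRoot (p : ℕ) (h : G) : G :=
  h ^ ((p : ZMod (orderOf h))⁻¹).val

/-- The map `g ↦ g_p * (g_{p'}) ^ (1 / p)` on group elements. -/
def zetaFun (p : ℕ) (g : G) : G :=
  pPart p g * pRoot p (pPrimePart p g)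

theorem mul_inv_val_modEq_one {a m : ℕ} (h : a.Coprime m) :
    a * ((a : ZMod m)⁻¹).val ≡ 1 [MOD m] := by
  rcases Nat.eq_zero_or_pos m with rfl | hm
  · have : a = 1 := by simpa using h
    subst this
    simp [Nat.ModEq, ZMod.val]
  · have : NeZero m := ⟨hm.ne'⟩
    rw [← ZMod.natCast_eq_natCast_iff]
    push_cast
    rw [ZMod.natCast_zmod_val, ZMod.coe_mul_inv_eq_one a h]

theorem coprime_ordProj_ordCompl {p n : ℕ} (hp : p.Prime) (hn : n ≠ 0) :
    (ordProj[p] n).Coprime (ordCompl[p] n) :=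
  (Nat.coprime_ordCompl hp hn).pow_left _

theorem pPart_mul_pPrimePart [Finite G] {p : ℕ} (hp : p.Prime) (g : G) :
    pPart p g * pPrimePart p g = g := by
  have h0 : orderOf g ≠ 0 := (orderOf_pos g).ne'
  have hc := coprime_ordProj_ordCompl hp h0
  unfold pPart pPrimePart
  rw [← pow_add]
  conv_rhs => rw [← pow_one g]
  rw [pow_eq_pow_iff_modEq]
  conv => arg 1; rw [← Nat.ordProj_mul_ordCompl_eq_self (orderOf g) p]
  rw [← Nat.modEq_and_modEq_iff_modEq_mul hc]
  constructor
  · exact (mul_inv_val_modEq_one hc.symm).add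
      ((Nat.modEq_zero_iff_dvd).2 (dvd_mul_right _ _))
  · have key := mul_inv_val_modEq_one hc
    rw [Nat.cast_pow] at key
    simpa only [Nat.zero_add] using ((Nat.modEq_zero_iff_dvd).2 (dvd_mul_right _ _)).add key

theorem pPart_pow_ordProj {p : ℕ} (g : G) : pPart p g ^ (ordProj[p] (orderOf g)) = 1 := by
  unfold pPart
  rw [← pow_mul, ← orderOf_dvd_iff_pow_eq_one]
  refine ⟨((ordCompl[p] (orderOf g) : ZMod (ordProj[p] (orderOf g)))⁻¹).val, ?_⟩
  conv_rhs => arg 1; rw [← Nat.ordProj_mul_ordCompl_eq_self (orderOf g) p]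
  ring

theorem pPrimePart_pow_ordCompl {p : ℕ} (g : G) :
    pPrimePart p g ^ (ordCompl[p] (orderOf g)) = 1 := by
  unfold pPrimePart
  rw [← pow_mul, ← orderOf_dvd_iff_pow_eq_one]
  refine ⟨((ordProj[p] (orderOf g) : ZMod (ordCompl[p] (orderOf g)))⁻¹).val, ?_⟩
  conv_rhs => arg 1; rw [← Nat.ordProj_mul_ordCompl_eq_self (orderOf g) p]
  ring

theorem coprime_orderOf_pPrimePart [Finite G] {p : ℕ} (hp : p.Prime) (g : G) :
    p.Coprime (orderOf (pPrimePart p g)) :=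
  (Nat.coprime_ordCompl hp (orderOf_pos g).ne').coprime_dvd_right
    (orderOf_dvd_of_pow_eq_one (pPrimePart_pow_ordCompl g))

theorem pRoot_pow {p : ℕ} {h : G} (hc : p.Coprime (orderOf h)) : pRoot p h ^ p = h := by
  unfold pRoot
  rw [← pow_mul, mul_comm]
  conv_rhs => rw [← pow_one h]
  rw [pow_eq_pow_iff_modEq]
  exact mul_inv_val_modEq_one hc

end GroupElements

section Zeta

variable (R : Type u) [CommRing R] (G : Type v) [Group G]

/-- The `R`-linear map `ζ_G : RG → RG` sending `g` to `g_p * (g_{p'}) ^ (1 / p)`. -/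
def zeta (p : ℕ) : R[G] →ₗ[R] R[G] where
  toFun := MonoidAlgebra.mapDomain (zetaFun p)
  map_add' := MonoidAlgebra.mapDomain_add _
  map_smul' r x := by
    apply MonoidAlgebra.coeff_injective
    simp [MonoidAlgebra.mapDomain, Finsupp.mapDomain_smul]

/-- A block of `RG`, given by its block idempotent: a primitive idempotent of the centre
of `RG`. -/
structure Block where
  /-- The block idempotent `e_B`. -/
  idem : R[G]
  isIdempotentElem : IsIdempotentElem idem
  mem_center : idem ∈ Subring.center R[G]
  ne_zero : idem ≠ 0
  primitive : ∀ f : R[G], IsIdempotentElem f → f ∈ Subring.center R[G] → f * idem = f →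
    f = 0 ∨ f = idem

variable {R G}

/-- The block algebra `B = RG e_B`, an `R`-algebra with identity element `e_B`. -/
def Block.alg (B : Block R G) : NonUnitalSubalgebra R R[G] where
  carrier := {x | ∃ a : R[G], x = a * B.idem}
  add_mem' := by
    rintro _ _ ⟨a, rfl⟩ ⟨b, rfl⟩
    exact ⟨a + b, (add_mul _ _ _).symm⟩
  zero_mem' := ⟨0, (zero_mul _).symm⟩
  mul_mem' := by
    rintro _ _ ⟨a, rfl⟩ ⟨b, rfl⟩
    exact ⟨a * B.idem * b, by simp only [mul_assoc]⟩
  smul_mem' := by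
    rintro r _ ⟨a, rfl⟩
    exact ⟨r • a, (smul_mul_assoc _ _ _).symm⟩

end Zeta

section Characters

/-- `χ` is the character of an irreducible representation of `G` over the field `Ω`. -/
def IsIrrChar {Ω : Type u} [Field Ω] {G : Type v} [Group G] (χ : G → Ω) : Prop :=
  ∃ (d : ℕ) (ρ : Representation Ω G (Fin d → Ω)), ρ.IsIrreducible ∧ ρ.character = χ

/-- The subfield of `Ω` generated by all roots of unity of `Ω`. For `Ω` algebraically closed of
characteristic zero this is the universal cyclotomic extension of `ℚ`. -/
def cyclotomicSubfield (Ω : Type u) [Field Ω] : Subfield Ω :=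
  Subfield.closure {ω : Ω | ∃ m : ℕ, 0 < m ∧ ω ^ m = 1}

/-- `σ` is the field automorphism of the universal cyclotomic extension that sends
`ω_p * ω_{p'}` to `ω_p * ω_{p'} ^ (p ^ n)`, for all roots of unity `ω_p` of `p`-power order
and `ω_{p'}` of order prime to `p`. -/
structure IsCyclotomicTwist {Ω : Type u} [Field Ω] (p n : ℕ)
    (σ : cyclotomicSubfield Ω ≃+* cyclotomicSubfield Ω) : Prop where
  pPower : ∀ (ω : cyclotomicSubfield Ω) (a : ℕ), ω ^ p ^ a = 1 → σ ω = ω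
  pPrime : ∀ (ω : cyclotomicSubfield Ω) (m : ℕ), p.Coprime m → 0 < m → ω ^ m = 1 →
    σ ω = ω ^ p ^ n

/-- `ψ = χ^{(p ^ n)}`, the composition of the (cyclotomic-valued) function `χ` with the field
automorphism `ω_p * ω_{p'} ↦ ω_p * ω_{p'} ^ (p ^ n)` of the universal cyclotomic extension. -/
def IsCharTwist {Ω : Type u} [Field Ω] {G : Type v} (p n : ℕ) (χ ψ : G → Ω) : Prop :=
  ∃ σ : cyclotomicSubfield Ω ≃+* cyclotomicSubfield Ω, IsCyclotomicTwist p n σ ∧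
    ∀ g : G, ∃ x : cyclotomicSubfield Ω, (x : Ω) = χ g ∧ ((σ x : cyclotomicSubfield Ω) : Ω) = ψ g

variable {O : Type u} [CommRing O] [IsDomain O] {G : Type v} [Group G]

/-- `χ ∈ Irr(B)`, for a block `B` of `OG` and a function `χ` with values in an algebraic
closure of the field of fractions `K` of `O`: it is an irreducible character of `G`
with `χ(e_B) ≠ 0`. -/
def Block.MemIrr (B : Block O G) (χ : G → AlgebraicClosure (FractionRing O)) : Prop :=
  IsIrrChar χ ∧
    (B.idem.coeff.sum fun g a => algebraMap O (AlgebraicClosure (FractionRing O)) a * χ g) ≠ 0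

/-- `C = B^{(p ^ n)}`: the block `C` is the one whose irreducible characters are the characters
`χ^{(p ^ n)}` for `χ ∈ Irr(B)`. -/
def Block.IsTwist (p n : ℕ) (B C : Block O G) : Prop :=
  ∀ χ : G → AlgebraicClosure (FractionRing O), B.MemIrr χ →
    ∃ ψ : G → AlgebraicClosure (FractionRing O), C.MemIrr ψ ∧ IsCharTwist p n χ ψ

end Characters

section StrongFrobenius

variable {O : Type u} [CommRing O] [IsDomain O] [IsLocalRing O] {G : Type v} [Group G]

/-- Reduction `OG → kG` of the coefficients, where `k` is the residue field of `O`. -/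
def reduction : O[G] →+* (IsLocalRing.ResidueField O)[G] :=
  MonoidAlgebra.mapRingHom G (IsLocalRing.residue O)

variable (p : ℕ) [Fact p.Prime] [CharP (IsLocalRing.ResidueField O) p] [IsAlgClosed (IsLocalRing.ResidueField O)]

/-- The inverse of the ring automorphism `∑ α_g g ↦ ∑ (α_g) ^ (p ^ n) g` of `kG`. -/
def frobInv (n : ℕ) : (IsLocalRing.ResidueField O)[G] →+* (IsLocalRing.ResidueField O)[G] :=
  MonoidAlgebra.mapRingHom G (iterateFrobeniusEquiv (IsLocalRing.ResidueField O) p n).symm.toRingHom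

variable {p}

/-- A strong `O`-Frobenius isomorphism of degree `n` from `B` to `C = B^{(p ^ n)}`: an isomorphism
`φ : B → C` of `O`-algebras which agrees with the `n`-fold iterate of `ζ_G` on the centre of `B`,
and such that, for every simple `B`-module `S` (that is, every simple `kG`-module on which `e_B`
acts as the identity), the `C`-module associated with `S` through `φ` (the group `S`, on which
`φ b` acts as `b`) is isomorphic to `S^{(p ^ n)}` (the group `S`, on which the element
`∑ (α_g) ^ (p ^ n) g` of `kG` acts as `∑ α_g g`). -/
structure IsStrongFrobeniusIso (n : ℕ) (B C : Block O G) (φ : B.alg ≃ₗ[O] C.alg) : Prop where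
  isTwist : B.IsTwist p n C
  map_mul : ∀ x y : B.alg, φ (x * y) = φ x * φ y
  eq_zeta : ∀ z : B.alg, (∀ b : B.alg, b * z = z * b) →
    (φ z : O[G]) = (zeta O G p)^[n] (z : O[G])
  simple : ∀ (S : Type (max u v)) [AddCommGroup S] [Module ((IsLocalRing.ResidueField O)[G]) S]
    [IsSimpleModule ((IsLocalRing.ResidueField O)[G]) S],
    (∀ s : S, reduction B.idem • s = s) →
      ∃ f : S ≃+ S, ∀ (b : B.alg) (s : S),
        f (reduction (b : O[G]) • s) = frobInv p n (reduction (φ b : O[G])) • f s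

variable (p)

/-- The positive integers `n` for which there is a strong `O`-Frobenius isomorphism of degree `n`
from `B` to `B^{(p ^ n)}`. -/
def Block.strongFrobeniusDegrees (B : Block O G) : Set ℕ :=
  {n | 0 < n ∧ ∃ (C : Block O G) (φ : B.alg ≃ₗ[O] C.alg), IsStrongFrobeniusIso (p := p) n B C φ}

/-- The strong `O`-Frobenius number `SOF(B)`: the smallest positive integer `n` for which there is
a strong `O`-Frobenius isomorphism of degree `n` from `B` to `B^{(p ^ n)}`. (It is taken
in `ℕ∞`, so that no convention is hidden in the existence of such an `n`.) -/
def Block.SOF (B : Block O G) : ℕ∞ :=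
  ⨅ n ∈ B.strongFrobeniusDegrees p, (n : ℕ∞)

end StrongFrobenius

/-- The natural `O`-algebra homomorphism `θ_Z : OG → O(G/Z)`. -/
def theta (O : Type u) [CommRing O] {G : Type v} [Group G] (Z : Subgroup G) [Z.Normal] :
    O[G] →ₐ[O] O[G ⧸ Z] :=
  MonoidAlgebra.mapDomainAlgHom O O (QuotientGroup.mk' Z)

end FrobeniusNumber

end

/-!
Write `N` for the sum of the elements of `Z`, a central element of `OG`. The kernel of `θ_Z` is
generated by the central elements `z - 1` with `z ∈ Z`, and it is also the annihilator of `N`,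
since `θ_Z(N) = |Z|` is not a zero divisor.

*The image of a block is a block.* As `Z` is a `p`-group, the ideal `I` generated by the `z - 1` in
the centre of `OG` is nilpotent modulo the maximal ideal of `O`. By Nakayama's lemma, a projection
`π` of `OG` that is linear over the centre and has image in ker `θ_Z = I OG` vanishes
(`eq_zero_of_theta_comp_eq_zero`), because its image `M` satisfies `M = π(M) ⊆ π(I OG) = I M`. With
right multiplication by `e_B` as projection this gives `θ_Z(e_B) ≠ 0`. A central idempotent `f` of
`O(G/Z)` lifts to an idempotent `u` of `OG` by completeness
(`exists_isIdempotentElem_theta_eq`); the projections `x ↦ u x (1 - u)` and `x ↦ (1 - u) x u` have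
image in the kernel, so they vanish and `u` is central. Primitivity of `θ_Z(e_B)` thus follows from
that of `e_B`.

*Strong Frobenius isomorphisms descend.* Let `φ : B → C` be one of degree `n`. Then
`φ(N e_B) = ζ_G^n(N e_B) = N ζ_G^n(e_B) = N e_C`, so `φ` commutes with multiplication by `N`
(`IsStrongFrobeniusIso.map_normMul`); hence it respects the kernels of `θ_Z` and induces an
isomorphism `ψ : B_Z → C_Z`. A central element `y = θ_Z(x)` of `B_Z` need not lift to the centre of
`B`, but `N x` is central and lifts `|Z| y`. So `|Z| ψ(y) = |Z| ζ_{G/Z}^n(y)`, and `|Z|` can be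
cancelled. The condition on simple modules passes to `B_Z` by inflation. So does the condition on
characters: the twist of an inflated character is constant on the cosets of `Z`, and by Schur's
lemma an irreducible representation with such a character is trivial on `Z`.
-/

open scoped MonoidAlgebra

noncomputable section

namespace FrobeniusNumber

universe u v

/-! ### The kernel of the quotient map -/

section CentralElements

variable {O : Type u} [CommRing O] {G : Type v} [Group G]

theorem single_mem_center {z : G} (hz : z ∈ Subgroup.center G) (r : O) :
    MonoidAlgebra.single z r ∈ Subalgebra.center O O[G] := by
  rw [Subalgebra.mem_center_iff]
  intro b
  exact (MonoidAlgebra.single_commute (fun g => (Subgroup.mem_center_iff.1 hz g).symm)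
    (fun s => Commute.all r s) b).symm.eq

variable (O) in
/-- The ideal of the centre of `OG` generated by the elements `z - 1` for `z` in the central
subgroup `Z`. -/
def augmentationIdeal (Z : Subgroup G) (hZ : Z ≤ Subgroup.center G) :
    Ideal (Subalgebra.center O O[G]) :=
  Ideal.span (Set.range fun z : Z =>
    (⟨MonoidAlgebra.single (z : G) 1, single_mem_center (hZ z.2) 1⟩ - 1))

theorem theta_single (Z : Subgroup G) [Z.Normal] (g : G) (r : O) :
    theta O Z (MonoidAlgebra.single g r) = MonoidAlgebra.single (g : G ⧸ Z) r := by
  simp [theta]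

theorem theta_surjective (Z : Subgroup G) [Z.Normal] : Function.Surjective (theta O Z) := by
  intro y
  induction y using MonoidAlgebra.induction_linear with
  | zero => exact ⟨0, map_zero _⟩
  | add a b ha hb =>
    obtain ⟨a, rfl⟩ := ha
    obtain ⟨b, rfl⟩ := hb
    exact ⟨a + b, map_add _ _ _⟩
  | single g r =>
    obtain ⟨g, rfl⟩ := QuotientGroup.mk_surjective g
    exact ⟨_, theta_single Z g r⟩

theorem theta_map_center (Z : Subgroup G) [Z.Normal] {x : O[G]}
    (hx : x ∈ Subring.center O[G]) : theta O Z x ∈ Subring.center O[G ⧸ Z] := by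
  rw [Subring.mem_center_iff] at hx ⊢
  intro y
  obtain ⟨y, rfl⟩ := theta_surjective Z y
  rw [← map_mul, hx, map_mul]

/-- The kernel of `θ_Z` is generated by the central elements `z - 1`. -/
theorem mem_augmentationIdeal_smul_of_theta_eq_zero (Z : Subgroup G) [Z.Normal]
    (hZ : Z ≤ Subgroup.center G) {x : O[G]} (hx : theta O Z x = 0) :
    x ∈ augmentationIdeal O Z hZ • (⊤ : Submodule (Subalgebra.center O O[G]) O[G]) := by
  -- Subtracting from `x` the lift of `θ_Z(x)` through a set of coset representatives
  -- replaces `g` by `g - g'` with `g = z * g'`, which equals `(z - 1) * g'`.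
  have key : ∀ x : O[G], x - MonoidAlgebra.mapDomain Quotient.out (theta O Z x) ∈
      augmentationIdeal O Z hZ • (⊤ : Submodule (Subalgebra.center O O[G]) O[G]) := by
    intro x
    induction x using MonoidAlgebra.induction_linear with
    | zero => simp
    | add a b ha hb =>
      rw [map_add, MonoidAlgebra.mapDomain_add, add_sub_add_comm]
      exact add_mem ha hb
    | single g r =>
      rw [theta_single, MonoidAlgebra.mapDomain_single]
      obtain ⟨w, hw⟩ := QuotientGroup.mk_out_eq_mul Z g
      have hw' : Quotient.out (g : G ⧸ Z) = g * w := hw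
      rw [hw']
      have hz : (g : G) = (w⁻¹ : Z) * (g * w) := by
        rw [Subgroup.mem_center_iff.1 (hZ w.2) g]; simp
      have : MonoidAlgebra.single g r - MonoidAlgebra.single (g * (w : G)) r =
          ((⟨MonoidAlgebra.single ((w⁻¹ : Z) : G) 1, single_mem_center (hZ (w⁻¹).2) 1⟩ - 1 :
            Subalgebra.center O O[G])) • MonoidAlgebra.single (g * (w : G)) r := by
        rw [sub_smul, one_smul]
        conv_lhs => rw [hz]
        congr 1
        · change _ = MonoidAlgebra.single ((w⁻¹ : Z) : G) 1 * MonoidAlgebra.single (g * (w : G)) r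
          rw [MonoidAlgebra.single_mul_single, one_mul, ← hz]
        · rw [← hz]
      rw [this]
      exact Submodule.smul_mem_smul (Ideal.subset_span ⟨_, rfl⟩) trivial
  simpa [hx] using key x

end CentralElements

/-! ### Nakayama's lemma for the kernel -/

theorem exists_sub_one_pow_eq_natCast_mul {A : Type u} [CommRing A] {p : ℕ} (hp : p.Prime) {c : A}
    {a : ℕ} (hc : c ^ p ^ a = 1) : ∃ r : A, (c - 1) ^ p ^ a = p * r := by
  obtain ⟨r, hr⟩ := exists_add_pow_prime_pow_eq hp (c - 1) 1 a
  rw [sub_add_cancel, hc, one_pow] at hr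
  exact ⟨-((c - 1) * r), by linear_combination -hr⟩

section Local

variable {p : ℕ} [Fact p.Prime]
  {O : Type u} [CommRing O] [IsLocalRing O]
  [CharP (IsLocalRing.ResidueField O) p]
  {G : Type v} [Group G] [Finite G]

theorem natCast_mem_maximalIdeal (p : ℕ) (O : Type u) [CommRing O] [IsLocalRing O]
    [CharP (IsLocalRing.ResidueField O) p] : (p : O) ∈ IsLocalRing.maximalIdeal O := by
  rw [← IsLocalRing.residue_eq_zero_iff, map_natCast, CharP.cast_eq_zero]

/-- As the group `Z` is a `p`-group, the elements `z - 1` are nilpotent modulo `p`. -/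
theorem exists_augmentationIdeal_pow_le (Z : Subgroup G) (hZ : Z ≤ Subgroup.center G)
    (hpZ : IsPGroup p Z) : ∃ N : ℕ, augmentationIdeal O Z hZ ^ N ≤
      (IsLocalRing.maximalIdeal O).map (algebraMap O (Subalgebra.center O O[G])) := by
  refine Ideal.exists_pow_le_of_le_radical_of_fg ?_
    (Submodule.fg_span (Set.finite_range _))
  rw [augmentationIdeal, Ideal.span_le]
  rintro _ ⟨z, rfl⟩
  obtain ⟨a, ha⟩ := hpZ z
  refine ⟨p ^ a, ?_⟩
  set c : Subalgebra.center O O[G] :=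
    ⟨MonoidAlgebra.single (z : G) 1, single_mem_center (hZ z.2) 1⟩ with hc
  have h1 : c ^ p ^ a = 1 := by
    apply Subtype.ext
    have hz : (z : G) ^ p ^ a = 1 := by exact_mod_cast congrArg Subtype.val ha
    simp [hc, MonoidAlgebra.single_pow, hz, MonoidAlgebra.one_def]
  obtain ⟨r, hr⟩ := exists_sub_one_pow_eq_natCast_mul (Fact.out : p.Prime) h1
  have hr' : (c - 1) ^ p ^ a = (p : Subalgebra.center O O[G]) * r := hr
  change (c - 1) ^ p ^ a ∈ _
  rw [hr']
  refine Ideal.mul_mem_right _ _ ?_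
  have := Ideal.mem_map_of_mem (algebraMap O (Subalgebra.center O O[G]))
    (natCast_mem_maximalIdeal p O)
  simpa using this

/-- Nakayama's lemma for the kernel of `θ_Z`: a projection of `OG` that is linear over the centre
and has image in the kernel of `θ_Z` vanishes. -/
theorem eq_zero_of_theta_comp_eq_zero [IsNoetherianRing O] (Z : Subgroup G) [Z.Normal]
    (hZ : Z ≤ Subgroup.center G) (hpZ : IsPGroup p Z)
    (π : O[G] →ₗ[Subalgebra.center O O[G]] O[G]) (hπ : ∀ x, π (π x) = π x)
    (h0 : ∀ x, theta O Z (π x) = 0) (x : O[G]) : π x = 0 := by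
  have hle : LinearMap.range π ≤ augmentationIdeal O Z hZ • LinearMap.range π := by
    rintro _ ⟨x, rfl⟩
    rw [← hπ, LinearMap.range_eq_map, ← Submodule.map_smul'']
    exact Submodule.mem_map_of_mem (mem_augmentationIdeal_smul_of_theta_eq_zero Z hZ (h0 x))
  have hpow : ∀ k : ℕ, LinearMap.range π ≤ augmentationIdeal O Z hZ ^ k • LinearMap.range π := by
    intro k
    induction k with
    | zero => simp
    | succ k ih =>
      rw [pow_succ, Submodule.mul_smul]
      exact ih.trans (Submodule.smul_mono le_rfl hle)
  obtain ⟨N, hN⟩ := exists_augmentationIdeal_pow_le (O := O) Z hZ hpZ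
  have h1 := (hpow N).trans (Submodule.smul_mono_left hN)
  have h2 : (LinearMap.range π).restrictScalars O ≤
      IsLocalRing.maximalIdeal O • (LinearMap.range π).restrictScalars O := by
    rw [← Ideal.smul_restrictScalars]
    exact h1
  have : Module.Finite O O[G] := Module.Finite.equiv (MonoidAlgebra.coeffLinearEquiv O).symm
  have h3 := Submodule.eq_bot_of_le_smul_of_le_jacobson_bot _ _ (IsNoetherian.noetherian _) h2
    (IsLocalRing.maximalIdeal_le_jacobson _)
  have h4 : π x ∈ (LinearMap.range π).restrictScalars O := ⟨x, rfl⟩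
  rw [h3] at h4
  simpa using h4

theorem eq_zero_of_isIdempotentElem_of_theta_eq_zero [IsNoetherianRing O] (Z : Subgroup G) [Z.Normal]
    (hZ : Z ≤ Subgroup.center G) (hpZ : IsPGroup p Z) {e : O[G]} (he : IsIdempotentElem e)
    (h : theta O Z e = 0) : e = 0 := by
  let π : O[G] →ₗ[Subalgebra.center O O[G]] O[G] :=
    { toFun := fun x => x * e
      map_add' := fun x y => add_mul _ _ _
      map_smul' := fun c x => mul_assoc _ _ _ }
  have := eq_zero_of_theta_comp_eq_zero Z hZ hpZ π
    (fun x => by change x * e * e = x * e; rw [mul_assoc, he.eq])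
    (fun x => by change theta O Z (x * e) = 0; rw [map_mul, h, mul_zero]) 1
  rwa [← one_mul e]

/-- For idempotents `u` and `v` whose images are orthogonal, with `θ_Z(u)` central, the projection
`x ↦ u x v` has image in the kernel of `θ_Z`, and so it vanishes. -/
theorem mul_mul_eq_zero_of_theta_mul_eq_zero [IsNoetherianRing O] (Z : Subgroup G) [Z.Normal]
    (hZ : Z ≤ Subgroup.center G) (hpZ : IsPGroup p Z) {u v : O[G]} (hu : IsIdempotentElem u)
    (hv : IsIdempotentElem v) (h : theta O Z u * theta O Z v = 0)
    (hc : theta O Z u ∈ Subring.center O[G ⧸ Z]) (x : O[G]) : u * x * v = 0 := by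
  let π : O[G] →ₗ[Subalgebra.center O O[G]] O[G] :=
    { toFun := fun x => u * x * v
      map_add' := fun x y => by rw [mul_add, add_mul]
      map_smul' := fun c x => by
        change u * ((c : O[G]) * x) * v = c * (u * x * v)
        rw [← mul_assoc u, Subalgebra.mem_center_iff.1 c.2 u]
        simp only [mul_assoc] }
  refine eq_zero_of_theta_comp_eq_zero Z hZ hpZ π (fun x => ?_) (fun x => ?_) x
  · change u * (u * x * v) * v = u * x * v
    rw [mul_assoc u (u * x * v), mul_assoc (u * x), hv.eq, ← mul_assoc, ← mul_assoc, hu.eq]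
  · change theta O Z (u * x * v) = 0
    rw [map_mul, map_mul, ← Subring.mem_center_iff.1 hc, mul_assoc, h, mul_zero]

end Local

/-! ### Lifting of idempotents -/

section Lifting

variable {O : Type u} [CommRing O]

theorem mul_mem_mul_smul_top {R : Type v} [Ring R] [Algebra O R]
    {I J : Ideal (Subalgebra.center O R)} {x y : R}
    (hx : x ∈ I • (⊤ : Submodule (Subalgebra.center O R) R))
    (hy : y ∈ J • (⊤ : Submodule (Subalgebra.center O R) R)) :
    x * y ∈ (I * J) • (⊤ : Submodule (Subalgebra.center O R) R) := by
  induction hx using Submodule.smul_induction_on' with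
  | smul a ha b hb =>
    induction hy using Submodule.smul_induction_on' with
    | smul c hc d hd =>
      have : (a • b) * (c • d) = (a * c) • (b * d) := by
        change ((a : R) * b) * ((c : R) * d) = ((a : R) * c) * (b * d)
        rw [mul_assoc, ← mul_assoc b, Subalgebra.mem_center_iff.1 c.2 b]
        simp only [mul_assoc]
      rw [this]
      exact Submodule.smul_mem_smul (Ideal.mul_mem_mul ha hc) trivial
    | add c hc d hd h1 h2 => rw [mul_add]; exact add_mem h1 h2
  | add c hc d hd h1 h2 => rw [add_mul]; exact add_mem h1 h2

/-- A step of Newton's iteration for `X ^ 2 - X` squares the defect `u ^ 2 - u`, up to a factor. -/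
theorem newton_sq_sub_self {R : Type v} [Ring R] (u : R) :
    (3 * u ^ 2 - 2 * u ^ 3) ^ 2 - (3 * u ^ 2 - 2 * u ^ 3) =
      (u ^ 2 - u) * (u ^ 2 - u) * (4 * (u ^ 2 - u) - 3) := by
  noncomm_ring

theorem newton_sub_self {R : Type v} [Ring R] (u : R) :
    (3 * u ^ 2 - 2 * u ^ 3) - u = (u ^ 2 - u) * (1 - 2 * u) := by
  noncomm_ring

theorem newton_of_isIdempotentElem {R : Type v} [Ring R] {f : R} (hf : IsIdempotentElem f) :
    3 * f ^ 2 - 2 * f ^ 3 = f := by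
  rw [pow_succ f 2, pow_two, hf.eq, hf.eq]
  noncomm_ring

variable [IsLocalRing O] {G : Type v} {ϖ : O}

theorem smodEq_maximalIdeal_pow_iff (hϖ : IsLocalRing.maximalIdeal O = Ideal.span {ϖ})
    {a b : O} {n : ℕ} :
    a ≡ b [SMOD (IsLocalRing.maximalIdeal O ^ n • ⊤ : Submodule O O)] ↔ ϖ ^ n ∣ a - b := by
  rw [SModEq.sub_mem, smul_eq_mul, Ideal.mul_top, hϖ, Ideal.span_singleton_pow,
    Ideal.mem_span_singleton]

theorem eq_zero_of_forall_eq_pow_smul (hϖ : IsLocalRing.maximalIdeal O = Ideal.span {ϖ})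
    [IsHausdorff (IsLocalRing.maximalIdeal O) O] {x : O[G]}
    (hx : ∀ n : ℕ, ∃ y : O[G], x = ϖ ^ n • y) : x = 0 := by
  apply MonoidAlgebra.coeff_injective
  ext g
  refine IsHausdorff.haus ‹_› _ fun n => ?_
  rw [smodEq_maximalIdeal_pow_iff hϖ, sub_zero]
  obtain ⟨y, rfl⟩ := hx n
  exact ⟨y.coeff g, rfl⟩

theorem exists_limit_of_sub_eq_pow_smul (hϖ : IsLocalRing.maximalIdeal O = Ideal.span {ϖ})
    [IsPrecomplete (IsLocalRing.maximalIdeal O) O] [Finite G]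
    {u : ℕ → O[G]} (hu : ∀ n : ℕ, ∃ y : O[G], u (n + 1) - u n = ϖ ^ n • y) :
    ∃ l : O[G], ∀ n : ℕ, ∃ y : O[G], u n = l + ϖ ^ n • y := by
  have hcauchy : ∀ g : G, ∀ {m n : ℕ}, m ≤ n → (u m).coeff g ≡ (u n).coeff g
      [SMOD (IsLocalRing.maximalIdeal O ^ m • ⊤ : Submodule O O)] := by
    intro g m n hmn
    induction n, hmn using Nat.le_induction with
    | base => exact SModEq.refl _
    | succ n hmn ih =>
      refine ih.trans (SModEq.symm ?_)
      rw [smodEq_maximalIdeal_pow_iff hϖ]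
      obtain ⟨y, hy⟩ := hu n
      have h := congrArg (fun x : O[G] => x.coeff g) hy
      simp only [MonoidAlgebra.coeff_sub, Finsupp.sub_apply] at h
      rw [h]
      exact (pow_dvd_pow ϖ hmn).trans ⟨y.coeff g, rfl⟩
  choose l hl using fun g => IsPrecomplete.prec ‹_› (hcauchy g)
  refine ⟨.ofCoeff (Finsupp.equivFunOnFinite.symm l), fun n => ?_⟩
  choose y hy using fun g => (smodEq_maximalIdeal_pow_iff hϖ).1 (hl g n)
  refine ⟨.ofCoeff (Finsupp.equivFunOnFinite.symm y), ?_⟩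
  apply MonoidAlgebra.coeff_injective
  ext g
  change (u n).coeff g = l g + ϖ ^ n * y g
  rw [← hy g]; ring

end Lifting

section Blocks

variable {p : ℕ} [Fact p.Prime]
  {O : Type u} [CommRing O] [IsDomain O] [IsDiscreteValuationRing O]
  [IsAdicComplete (IsLocalRing.maximalIdeal O) O]
  [CharP (IsLocalRing.ResidueField O) p]
  {G : Type v} [Group G] [Finite G]

/-- Idempotents of `O(G/Z)` lift to idempotents of `OG`: Newton's iteration
`u ↦ 3 u ^ 2 - 2 u ^ 3` turns any lift into one that is idempotent up to the maximal ideal of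
`O`, since the kernel of `θ_Z` is nilpotent modulo that ideal, and then converges. -/
theorem exists_isIdempotentElem_theta_eq (Z : Subgroup G) [Z.Normal]
    (hZ : Z ≤ Subgroup.center G) (hpZ : IsPGroup p Z) {f : O[G ⧸ Z]}
    (hf : IsIdempotentElem f) : ∃ u : O[G], IsIdempotentElem u ∧ theta O Z u = f := by
  obtain ⟨ϖ, hirr⟩ := IsDiscreteValuationRing.exists_irreducible O
  have hϖ : IsLocalRing.maximalIdeal O = Ideal.span {ϖ} := hirr.maximalIdeal_eq
  obtain ⟨u₀, hu₀⟩ := theta_surjective Z f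
  let newton : O[G] → O[G] := fun u => 3 * u ^ 2 - 2 * u ^ 3
  let u : ℕ → O[G] := fun n => newton^[n] u₀
  have hsucc : ∀ n, u (n + 1) = 3 * u n ^ 2 - 2 * u n ^ 3 := fun n =>
    Function.iterate_succ_apply' newton n u₀
  have htheta : ∀ n, theta O Z (u n) = f := by
    intro n
    induction n with
    | zero => exact hu₀
    | succ n ih =>
      rw [hsucc, map_sub, map_mul, map_mul, map_pow, map_pow, ih, map_ofNat, map_ofNat]
      exact newton_of_isIdempotentElem hf
  -- The defect lies in the kernel of `θ_Z`, and each step squares the power of the augmentation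
  -- ideal that contains it, until that power lies in the maximal ideal of `O`.
  have hker : ∀ n, u n ^ 2 - u n ∈ augmentationIdeal O Z hZ ^ 2 ^ n •
      (⊤ : Submodule (Subalgebra.center O O[G]) O[G]) := by
    intro n
    induction n with
    | zero =>
      rw [pow_zero, pow_one]
      refine mem_augmentationIdeal_smul_of_theta_eq_zero Z hZ ?_
      rw [map_sub, map_pow, htheta, pow_two, hf.eq, sub_self]
    | succ n ih =>
      rw [hsucc, newton_sq_sub_self, pow_succ 2, mul_two, pow_add, ← mul_one (_ * _ : Ideal _)]
      refine mul_mem_mul_smul_top (mul_mem_mul_smul_top ih ih) ?_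
      rw [Ideal.one_eq_top, Submodule.top_smul]
      trivial
  obtain ⟨N, hN⟩ := exists_augmentationIdeal_pow_le (O := O) Z hZ hpZ
  have hbase : ∃ y : O[G], u N ^ 2 - u N = ϖ ^ 1 • y := by
    have h1 : u N ^ 2 - u N ∈ ((IsLocalRing.maximalIdeal O).map
        (algebraMap O (Subalgebra.center O O[G])) •
        (⊤ : Submodule (Subalgebra.center O O[G]) O[G])).restrictScalars O :=
      Submodule.smul_mono_left ((Ideal.pow_le_pow_right Nat.lt_two_pow_self.le).trans hN) (hker N)
    rw [Ideal.smul_restrictScalars, hϖ, Submodule.ideal_span_singleton_smul] at h1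
    obtain ⟨y, -, hy⟩ := h1
    exact ⟨y, by rw [pow_one]; exact hy.symm⟩
  have hdiv : ∀ n : ℕ, ∃ y : O[G], u (N + n) ^ 2 - u (N + n) = ϖ ^ (n + 1) • y := by
    intro n
    induction n with
    | zero => exact hbase
    | succ n ih =>
      obtain ⟨y, hy⟩ := ih
      refine ⟨ϖ ^ n • (y * y * (4 * (ϖ ^ (n + 1) • y) - 3)), ?_⟩
      rw [← add_assoc, hsucc, newton_sq_sub_self, hy, smul_mul_smul_comm, smul_mul_assoc, smul_smul,
        ← pow_add, ← pow_add]
      congr 2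
      ring
  obtain ⟨l, hl⟩ := exists_limit_of_sub_eq_pow_smul hϖ (u := fun n => u (N + n)) fun n => by
    obtain ⟨y, hy⟩ := hdiv n
    refine ⟨ϖ • (y * (1 - 2 * u (N + n))), ?_⟩
    rw [← add_assoc, hsucc, newton_sub_self, hy, smul_mul_assoc, smul_smul, ← pow_succ]
  refine ⟨l, ?_, ?_⟩
  · rw [IsIdempotentElem, ← sub_eq_zero]
    refine eq_zero_of_forall_eq_pow_smul hϖ fun n => ?_
    obtain ⟨y, hy⟩ := hl n
    obtain ⟨w, hw⟩ := hdiv n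
    have hl' : l = u (N + n) - ϖ ^ n • y := by rw [hy, add_sub_cancel_right]
    refine ⟨ϖ • w - (l * y + y * l + ϖ ^ n • (y * y)) + y, ?_⟩
    rw [hy] at hw
    rw [pow_succ ϖ n, mul_smul] at hw
    rw [smul_add, smul_sub, ← hw]
    simp only [pow_two, add_mul, mul_add, smul_add, smul_mul_assoc, mul_smul_comm]
    abel
  · rw [← sub_eq_zero]
    refine eq_zero_of_forall_eq_pow_smul hϖ fun n => ?_
    obtain ⟨y, hy⟩ := hl n
    refine ⟨-theta O Z y, ?_⟩
    rw [← htheta (N + n), hy, map_add, map_smul, smul_neg]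
    abel

/-! ### The image of a block -/

/-- The block `B_Z = θ_Z(B)` of `O(G/Z)`. -/
def Block.quotient (B : Block O G) (Z : Subgroup G) [Z.Normal]
    (hZ : Z ≤ Subgroup.center G) (hpZ : IsPGroup p Z) : Block O (G ⧸ Z) where
  idem := theta O Z B.idem
  isIdempotentElem := B.isIdempotentElem.map _
  mem_center := theta_map_center Z B.mem_center
  ne_zero h := B.ne_zero
    (eq_zero_of_isIdempotentElem_of_theta_eq_zero Z hZ hpZ B.isIdempotentElem h)
  primitive f hf hc hfe := by
    obtain ⟨u, hu, rfl⟩ := exists_isIdempotentElem_theta_eq Z hZ hpZ hf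
    have h1 : theta O Z (1 - u) = 1 - theta O Z u := by rw [map_sub, map_one]
    -- The lift `u` is central since `u OG (1 - u)` and `(1 - u) OG u` vanish.
    have huc : u ∈ Subring.center O[G] := by
      rw [Subring.mem_center_iff]
      intro x
      have h2 := mul_mul_eq_zero_of_theta_mul_eq_zero Z hZ hpZ hu hu.one_sub
        (by rw [h1, hf.mul_one_sub_self]) hc x
      have h3 := mul_mul_eq_zero_of_theta_mul_eq_zero Z hZ hpZ hu.one_sub hu
        (by rw [h1, hf.one_sub_mul_self])
        (by rw [h1]; exact sub_mem (one_mem _) hc) x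
      rw [mul_sub, mul_one, sub_eq_zero] at h2
      rw [sub_mul, one_mul, sub_mul, sub_eq_zero] at h3
      exact h3.trans h2.symm
    have hcomm : u * B.idem = B.idem * u := Subring.mem_center_iff.1 B.mem_center u
    rcases B.primitive (u * B.idem) (hu.mul_of_commute hcomm B.isIdempotentElem)
      (mul_mem huc B.mem_center) (by rw [mul_assoc, B.isIdempotentElem.eq]) with h | h
    · left
      rw [← hfe, ← map_mul, h, map_zero]
    · right
      rw [← hfe, ← map_mul, h]

end Blocks

/-! ### The map `ζ_G` on group elements -/

section GroupElements

variable {G : Type u} [Group G] {p : ℕ}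

theorem coprime_orderOf_of_pow_eq_one {x : G} {m : ℕ} (hm : p.Coprime m) (hx : x ^ m = 1) :
    p.Coprime (orderOf x) :=
  hm.coprime_dvd_right (orderOf_dvd_of_pow_eq_one hx)

theorem eq_one_of_pow_prime_pow_eq_one {x : G} {i : ℕ} (hx : x ^ p ^ i = 1)
    (hc : p.Coprime (orderOf x)) : x = 1 := by
  rw [← orderOf_eq_one_iff]
  exact Nat.eq_one_of_dvd_coprimes (hc.pow_left i) (orderOf_dvd_of_pow_eq_one hx) dvd_rfl

/-- Uniqueness of the decomposition of `g` into commuting `p`- and `p'`-parts. -/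
theorem pPart_eq_and_pPrimePart_eq [Finite G] (hp : p.Prime) {g a b : G}
    (hab : a * b = g)
    (hcomm : Commute a b) {i : ℕ} (ha : a ^ p ^ i = 1) (hb : p.Coprime (orderOf b)) :
    pPart p g = a ∧ pPrimePart p g = b := by
  have hmul := pPart_mul_pPrimePart hp g
  have hag : Commute a g := hab ▸ (Commute.refl a).mul_right hcomm
  have hbg : Commute b g := hab ▸ hcomm.symm.mul_right (Commute.refl b)
  have hap : Commute a (pPart p g) := hag.pow_right _
  have hbq : Commute b (pPrimePart p g) := hbg.pow_right _
  have heq : a⁻¹ * pPart p g = b * (pPrimePart p g)⁻¹ := by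
    rw [inv_mul_eq_iff_eq_mul, ← mul_assoc, hab, eq_mul_inv_iff_mul_eq, hmul]
  have h1 : (a⁻¹ * pPart p g) ^ p ^ (i + (orderOf g).factorization p) = 1 := by
    rw [hap.inv_left.mul_pow, inv_pow, pow_add, pow_mul, ha, one_pow, mul_comm (p ^ i), pow_mul,
      pPart_pow_ordProj, one_pow, inv_one, one_mul]
  have h2 : p.Coprime (orderOf (a⁻¹ * pPart p g)) := by
    refine coprime_orderOf_of_pow_eq_one
      (hb.mul_right (coprime_orderOf_pPrimePart hp g)) ?_
    rw [heq, hbq.inv_right.mul_pow, pow_mul, pow_orderOf_eq_one, one_pow, inv_pow,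
      mul_comm (orderOf b), pow_mul, pow_orderOf_eq_one, one_pow, inv_one, one_mul]
  have h3 := eq_one_of_pow_prime_pow_eq_one h1 h2
  have h4 : pPart p g = a := (inv_mul_eq_one.1 h3).symm
  rw [h3] at heq
  exact ⟨h4, (mul_inv_eq_one.1 heq.symm).symm⟩

theorem pRoot_eq {h x : G} (hx : x ^ p = h) (hc : p.Coprime (orderOf x)) : pRoot p h = x := by
  have hh : p.Coprime (orderOf h) := by
    refine coprime_orderOf_of_pow_eq_one hc ?_
    rw [← hx, ← pow_mul, mul_comm, pow_mul, pow_orderOf_eq_one, one_pow]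
  have hcomm : Commute x (pRoot p h) := by
    unfold pRoot
    rw [← hx]
    exact ((Commute.refl x).pow_right _).pow_right _
  have hr : pRoot p h ^ orderOf h = 1 := by
    unfold pRoot
    rw [← pow_mul, mul_comm, pow_mul, pow_orderOf_eq_one, one_pow]
  have h1 : (x⁻¹ * pRoot p h) ^ p ^ 1 = 1 := by
    rw [pow_one, hcomm.inv_left.mul_pow, pRoot_pow hh, inv_pow, hx, inv_mul_cancel]
  have h2 : p.Coprime (orderOf (x⁻¹ * pRoot p h)) := by
    refine coprime_orderOf_of_pow_eq_one (hc.mul_right hh) ?_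
    rw [hcomm.inv_left.mul_pow, inv_pow, pow_mul, pow_orderOf_eq_one, one_pow, inv_one, one_mul,
      mul_comm, pow_mul, hr, one_pow]
  exact (inv_mul_eq_one.1 (eq_one_of_pow_prime_pow_eq_one h1 h2)).symm

theorem map_zetaFun [Finite G] {H : Type v} [Group H] [Finite H] (hp : p.Prime) (f : G →* H)
    (g : G) :
    zetaFun p (f g) = f (zetaFun p g) := by
  have hq := coprime_orderOf_pPrimePart hp g
  obtain ⟨h1, h2⟩ := pPart_eq_and_pPrimePart_eq hp (g := f g) (a := f (pPart p g))
    (b := f (pPrimePart p g)) (by rw [← map_mul, pPart_mul_pPrimePart hp])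
    ((((Commute.refl g).pow_pow _ _ : Commute (pPart p g) (pPrimePart p g))).map f)
    (by rw [← map_pow, pPart_pow_ordProj, map_one])
    (hq.coprime_dvd_right (orderOf_map_dvd _ _))
  have h3 : pRoot p (f (pPrimePart p g)) = f (pRoot p (pPrimePart p g)) := by
    refine pRoot_eq (by rw [← map_pow, pRoot_pow hq]) ?_
    refine (coprime_orderOf_of_pow_eq_one hq ?_).coprime_dvd_right (orderOf_map_dvd _ _)
    rw [pRoot, ← pow_mul, mul_comm, pow_mul, pow_orderOf_eq_one, one_pow]
  rw [zetaFun, h1, h2, h3, zetaFun, map_mul]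

theorem zetaFun_mul_of_mem_center [Finite G] (hp : p.Prime) {z : G}
    (hz : z ∈ Subgroup.center G) {i : ℕ}
    (hi : z ^ p ^ i = 1) (g : G) : zetaFun p (z * g) = z * zetaFun p g := by
  have hcen : ∀ x, Commute z x := fun x => (Subgroup.mem_center_iff.1 hz x).symm
  obtain ⟨h1, h2⟩ := pPart_eq_and_pPrimePart_eq hp (g := z * g) (a := z * pPart p g)
    (b := pPrimePart p g) (by rw [mul_assoc, pPart_mul_pPrimePart hp])
    ((hcen _).mul_left ((Commute.refl g).pow_pow _ _))
    (i := i + (orderOf g).factorization p)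
    (by rw [(hcen _).mul_pow, pow_add, pow_mul, hi, one_pow, one_mul, mul_comm, pow_mul,
          pPart_pow_ordProj, one_pow])
    (coprime_orderOf_pPrimePart hp g)
  rw [zetaFun, h1, h2, zetaFun, mul_assoc]

end GroupElements

/-! ### The sum of the elements of `Z` -/

section Norm

variable {O : Type u} [CommRing O] {G : Type v} [Group G] [Finite G]

variable (O) in
/-- The sum of the elements of the subgroup `Z`. -/
def normElement (Z : Subgroup G) : O[G] :=
  haveI := Fintype.ofFinite Z
  ∑ z : Z, MonoidAlgebra.single (z : G) 1

theorem normElement_mem_center (Z : Subgroup G) (hZ : Z ≤ Subgroup.center G) :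
    normElement O Z ∈ Subring.center O[G] :=
  sum_mem fun z _ => single_mem_center (hZ z.2) 1

theorem normElement_mul_single_mul (Z : Subgroup G) (z : Z) (g : G) (r : O) :
    normElement O Z * MonoidAlgebra.single ((z : G) * g) r =
      normElement O Z * MonoidAlgebra.single g r := by
  let := Fintype.ofFinite Z
  simp only [normElement, Finset.sum_mul, MonoidAlgebra.single_mul_single, one_mul, ← mul_assoc]
  exact Fintype.sum_equiv (Equiv.mulRight z)
    (fun w : Z => (MonoidAlgebra.single ((w : G) * z * g) r : O[G]))
    (fun w : Z => MonoidAlgebra.single ((w : G) * g) r) fun w => by simp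

/-- Multiplication by the sum of the elements of `Z` factors through `θ_Z`. -/
theorem normElement_mul_mapDomain_out (Z : Subgroup G) [Z.Normal] (hZ : Z ≤ Subgroup.center G)
    (x : O[G]) : normElement O Z * MonoidAlgebra.mapDomain Quotient.out (theta O Z x) =
      normElement O Z * x := by
  induction x using MonoidAlgebra.induction_linear with
  | zero => simp
  | add a b ha hb => rw [map_add, MonoidAlgebra.mapDomain_add, mul_add, ha, hb, mul_add]
  | single g r =>
    rw [theta_single, MonoidAlgebra.mapDomain_single]
    obtain ⟨w, hw⟩ := QuotientGroup.mk_out_eq_mul Z g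
    have hw' : Quotient.out (g : G ⧸ Z) = (w : G) * g := by
      rw [← Subgroup.mem_center_iff.1 (hZ w.2) g]; exact hw
    rw [hw', normElement_mul_single_mul]

theorem theta_normElement_mul (Z : Subgroup G) [Z.Normal] (x : O[G]) :
    theta O Z (normElement O Z * x) = Nat.card Z • theta O Z x := by
  let := Fintype.ofFinite Z
  have h1 : theta O Z (normElement O Z) = Nat.card Z • 1 := by
    rw [normElement, map_sum, Nat.card_eq_fintype_card, ← Finset.card_univ, ← Finset.sum_const]
    refine Finset.sum_congr rfl fun z _ => ?_
    rw [theta_single, (QuotientGroup.eq_one_iff (z : G)).2 z.2, MonoidAlgebra.one_def]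
  rw [map_mul, h1, smul_mul_assoc, one_mul]

theorem natCard_smul_left_cancel [IsDomain O] [CharZero O] (Z : Subgroup G) {H : Type v}
    {x y : O[H]} (h : Nat.card Z • x = Nat.card Z • y) : x = y := by
  have h0 : (Nat.card Z : O) ≠ 0 := Nat.cast_ne_zero.2 Nat.card_pos.ne'
  apply MonoidAlgebra.coeff_injective
  ext g
  have h2 : Nat.card Z • x.coeff g = Nat.card Z • y.coeff g :=
    congrArg (fun x : O[H] => x.coeff g) h
  rw [nsmul_eq_mul, nsmul_eq_mul] at h2
  exact mul_left_cancel₀ h0 h2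

/-- The kernel of `θ_Z` is the annihilator of the sum of the elements of `Z`. -/
theorem theta_eq_zero_iff [IsDomain O] [CharZero O] (Z : Subgroup G) [Z.Normal]
    (hZ : Z ≤ Subgroup.center G) (x : O[G]) :
    theta O Z x = 0 ↔ normElement O Z * x = 0 := by
  constructor
  · intro h
    rw [← normElement_mul_mapDomain_out Z hZ, h, MonoidAlgebra.mapDomain_zero, mul_zero]
  · intro h
    refine natCard_smul_left_cancel Z ?_
    rw [← theta_normElement_mul, h, map_zero, smul_zero]

end Norm

/-! ### The map `ζ_G` on the group ring -/

section Zeta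

variable {p : ℕ} {O : Type u} [CommRing O] {G : Type v} [Group G]

theorem zeta_single (p : ℕ) (g : G) (r : O) :
    zeta O G p (MonoidAlgebra.single g r) = MonoidAlgebra.single (zetaFun p g) r :=
  MonoidAlgebra.mapDomain_single

theorem theta_zeta [Finite G] (hp : p.Prime) (Z : Subgroup G) [Z.Normal] (x : O[G]) :
    theta O Z (zeta O G p x) = zeta O (G ⧸ Z) p (theta O Z x) := by
  induction x using MonoidAlgebra.induction_linear with
  | zero => simp
  | add a b ha hb => simp only [map_add, ha, hb]
  | single g r =>
    rw [zeta_single, theta_single, theta_single, zeta_single]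
    congr 1
    exact (map_zetaFun hp (QuotientGroup.mk' Z) g).symm

theorem theta_zeta_iterate [Finite G] (hp : p.Prime) (Z : Subgroup G) [Z.Normal] (n : ℕ)
    (x : O[G]) :
    theta O Z ((zeta O G p)^[n] x) = (zeta O (G ⧸ Z) p)^[n] (theta O Z x) :=
  Function.Semiconj.iterate_right (f := theta O Z) (theta_zeta hp Z) n x

theorem zeta_normElement_mul [Finite G] (hp : p.Prime) (Z : Subgroup G) (hZ : Z ≤ Subgroup.center G)
    (hpZ : IsPGroup p Z) (x : O[G]) :
    zeta O G p (normElement O Z * x) = normElement O Z * zeta O G p x := by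
  induction x using MonoidAlgebra.induction_linear with
  | zero => simp
  | add a b ha hb => simp only [map_add, mul_add, ha, hb]
  | single g r =>
    simp only [normElement, Finset.sum_mul, MonoidAlgebra.single_mul_single, one_mul, map_sum,
      zeta_single]
    refine Finset.sum_congr rfl fun z _ => ?_
    obtain ⟨i, hi⟩ := hpZ z
    rw [zetaFun_mul_of_mem_center hp (hZ z.2) (i := i) (by exact_mod_cast congrArg Subtype.val hi)]

theorem zeta_iterate_normElement_mul [Finite G] (hp : p.Prime) (Z : Subgroup G)
    (hZ : Z ≤ Subgroup.center G) (hpZ : IsPGroup p Z) (n : ℕ) (x : O[G]) :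
    (zeta O G p)^[n] (normElement O Z * x) = normElement O Z * (zeta O G p)^[n] x :=
  ((Function.Semiconj.iterate_right (f := fun x : O[G] => normElement O Z * x)
    (fun x => (zeta_normElement_mul hp Z hZ hpZ x).symm) n) x).symm

end Zeta

/-! ### Inflation of irreducible characters -/

section Characters

variable {Ω : Type u} [Field Ω] {G : Type v} [Group G]

theorem isIrreducible_comp_iff {H : Type*} [Group H] {V : Type*} [AddCommGroup V] [Module Ω V]
    (ρ : Representation Ω H V) (f : G →* H) (hf : Function.Surjective f) :
    Representation.IsIrreducible (ρ.comp f) ↔ ρ.IsIrreducible := by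
  let e : Subrepresentation (ρ.comp f) ≃o Subrepresentation ρ :=
    { toFun := fun W => ⟨W.toSubmodule, fun h v hv => by
        obtain ⟨g, rfl⟩ := hf h
        exact W.apply_mem_toSubmodule g hv⟩
      invFun := fun W => ⟨W.toSubmodule, fun g v hv => W.apply_mem_toSubmodule (f g) hv⟩
      left_inv := fun _ => rfl
      right_inv := fun _ => rfl
      map_rel_iff' := Iff.rfl }
  exact e.isSimpleOrder_iff

theorem IsIrrChar.comp_mk {Z : Subgroup G} [Z.Normal] {χ : G ⧸ Z → Ω} (h : IsIrrChar χ) :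
    IsIrrChar fun g : G => χ (g : G ⧸ Z) := by
  obtain ⟨d, ρ, hρ, rfl⟩ := h
  exact ⟨d, ρ.comp (QuotientGroup.mk' Z),
    (isIrreducible_comp_iff ρ _ (QuotientGroup.mk'_surjective Z)).2 hρ, rfl⟩

/-- By Schur's lemma a central element acts as a scalar, which is determined by the character. -/
theorem apply_eq_one_of_character_eq [IsAlgClosed Ω] [CharZero Ω] {d : ℕ}
    (ρ : Representation Ω G (Fin d → Ω)) [hρ : ρ.IsIrreducible] {z : G}
    (hz : z ∈ Subgroup.center G) (h : ρ.character z = ρ.character 1) : ρ z = 1 := by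
  let T : ρ.IntertwiningMap ρ :=
    (ρ z).intertwiningMap_of_isIntertwiningMap (ρ := ρ) (σ := ρ) fun g v => by
      rw [← Module.End.mul_apply, ← map_mul, ← Subgroup.mem_center_iff.1 hz g, map_mul,
        Module.End.mul_apply]
  obtain ⟨c, hc⟩ :=
    Representation.IsIrreducible.algebraMap_intertwiningMap_bijective_of_isAlgClosed.2 T
  have hρz : ρ z = c • 1 := by
    refine LinearMap.ext fun v => ?_
    exact congrArg (fun S : ρ.IntertwiningMap ρ => S v) hc.symm
  have hd : (d : Ω) ≠ 0 := by
    rw [Nat.cast_ne_zero]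
    rintro rfl
    obtain ⟨W₁, W₂, hW⟩ := hρ.exists_pair_ne
    exact hW (Subrepresentation.toSubmodule_injective (Subsingleton.elim _ _))
  have hc1 : c * d = d := by
    have h2 := h
    rw [Representation.char_one] at h2
    rw [Representation.character, hρz, map_smul, LinearMap.trace_one] at h2
    simpa using h2
  rw [hρz, mul_eq_right₀ hd |>.1 hc1, one_smul]

/-- An irreducible character that is constant on the central subgroup `Z` is inflated from `G/Z`. -/
theorem IsIrrChar.exists_eq_comp_mk [IsAlgClosed Ω] [CharZero Ω] {Z : Subgroup G} [Z.Normal]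
    (hZ : Z ≤ Subgroup.center G) {ψ : G → Ω} (h : IsIrrChar ψ) (h1 : ∀ z ∈ Z, ψ z = ψ 1) :
    ∃ ψ' : G ⧸ Z → Ω, IsIrrChar ψ' ∧ ∀ g : G, ψ' (g : G ⧸ Z) = ψ g := by
  obtain ⟨d, ρ, hρ, rfl⟩ := h
  have : Representation.IsTrivial (ρ.comp Z.subtype) :=
    ⟨fun z => apply_eq_one_of_character_eq ρ (hZ z.2) (h1 z z.2)⟩
  refine ⟨(ρ.ofQuotient Z).character, ⟨d, ρ.ofQuotient Z, ?_, rfl⟩, fun g => rfl⟩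
  rw [← isIrreducible_comp_iff _ (QuotientGroup.mk' Z) (QuotientGroup.mk'_surjective Z)]
  exact hρ

end Characters

/-! ### Twists of blocks -/

section Blocks

variable {O : Type u} [CommRing O] {G : Type v} [Group G]

theorem sum_coeff_theta {Ω : Type*} [CommRing Ω] [Algebra O Ω] (Z : Subgroup G) [Z.Normal]
    (χ : G ⧸ Z → Ω) (x : O[G]) :
    ((theta O Z x).coeff.sum fun g a => algebraMap O Ω a * χ g) =
      x.coeff.sum fun g a => algebraMap O Ω a * χ (g : G ⧸ Z) :=
  Finsupp.sum_mapDomain_index (by simp) (by intros; rw [map_add, add_mul])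

theorem Block.memIrr_iff_of_idem_eq_theta [IsDomain O] {Z : Subgroup G} [Z.Normal]
    {B : Block O G} {B' : Block O (G ⧸ Z)} (hB : B'.idem = theta O Z B.idem)
    {χ : G ⧸ Z → AlgebraicClosure (FractionRing O)} (hχ : IsIrrChar χ) :
    B'.MemIrr χ ↔ B.MemIrr fun g : G => χ (g : G ⧸ Z) := by
  rw [Block.MemIrr, Block.MemIrr, hB, sum_coeff_theta]
  exact and_congr_left fun _ => iff_of_true hχ hχ.comp_mk

theorem Block.IsTwist.of_idem_eq_theta [IsDomain O] [CharZero O] {p n : ℕ} {Z : Subgroup G}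
    [Z.Normal] (hZ : Z ≤ Subgroup.center G)
    {B C : Block O G} {B' C' : Block O (G ⧸ Z)} (hB : B'.idem = theta O Z B.idem)
    (hC : C'.idem = theta O Z C.idem) (h : B.IsTwist p n C) : B'.IsTwist p n C' := by
  intro χ hχ
  obtain ⟨ψ, hψ, σ, hσ, hval⟩ := h _ ((Block.memIrr_iff_of_idem_eq_theta hB hχ.1).1 hχ)
  have hfactor : ∀ g₁ g₂ : G, (g₁ : G ⧸ Z) = g₂ → ψ g₁ = ψ g₂ := by
    intro g₁ g₂ h12
    obtain ⟨x₁, hx₁, hy₁⟩ := hval g₁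
    obtain ⟨x₂, hx₂, hy₂⟩ := hval g₂
    have : x₁ = x₂ := Subtype.ext (hx₁.trans ((congrArg χ h12).trans hx₂.symm))
    rw [← hy₁, ← hy₂, this]
  have : CharZero (FractionRing O) :=
    charZero_of_injective_algebraMap (IsFractionRing.injective O (FractionRing O))
  have : CharZero (AlgebraicClosure (FractionRing O)) :=
    charZero_of_injective_algebraMap (algebraMap (FractionRing O) _).injective
  obtain ⟨ψ', hψ', hψψ'⟩ := hψ.1.exists_eq_comp_mk hZ fun z hz =>
    hfactor z 1 ((QuotientGroup.eq_one_iff z).2 hz)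
  obtain rfl : (fun g : G => ψ' (g : G ⧸ Z)) = ψ := funext hψψ'
  refine ⟨ψ', (Block.memIrr_iff_of_idem_eq_theta hC hψ').2 hψ, σ, hσ, fun g => ?_⟩
  obtain ⟨g, rfl⟩ := QuotientGroup.mk_surjective g
  exact hval g

end Blocks

/-! ### Descent of strong Frobenius isomorphisms -/

theorem exists_linearEquiv_of_surjective {R M N M' N' : Type*} [Ring R] [AddCommGroup M]
    [AddCommGroup N] [AddCommGroup M'] [AddCommGroup N'] [Module R M] [Module R N] [Module R M']
    [Module R N'] {a : M →ₗ[R] M'} {c : N →ₗ[R] N'} (ha : Function.Surjective a)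
    (hc : Function.Surjective c) (φ : M ≃ₗ[R] N) (h : ∀ x, a x = 0 ↔ c (φ x) = 0) :
    ∃ ψ : M' ≃ₗ[R] N', ∀ x, ψ (a x) = c (φ x) := by
  have hker : a.ker.map (φ : M →ₗ[R] N) = c.ker := by
    ext y
    obtain ⟨x, rfl⟩ := φ.surjective y
    rw [LinearMap.mem_ker, ← h]
    exact ⟨fun ⟨z, hz, hzx⟩ => φ.injective hzx ▸ hz, fun hx => ⟨x, hx, rfl⟩⟩
  refine ⟨(a.quotKerEquivOfSurjective ha).symm ≪≫ₗ Submodule.Quotient.equiv _ _ φ hker ≪≫ₗ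
    c.quotKerEquivOfSurjective hc, fun x => ?_⟩
  have : (a.quotKerEquivOfSurjective ha).symm (a x) = Submodule.Quotient.mk x := by
    rw [LinearEquiv.symm_apply_eq]
    rfl
  simp only [LinearEquiv.trans_apply, this]
  rfl

section BlockAlgebra

variable {O : Type u} [CommRing O] {G : Type v} [Group G]

theorem Block.mul_idem {B : Block O G} (x : B.alg) : (x : O[G]) * B.idem = x := by
  obtain ⟨_, a, rfl⟩ := x
  rw [mul_assoc, B.isIdempotentElem.eq]

theorem Block.idem_mul {B : Block O G} (x : B.alg) : B.idem * (x : O[G]) = x := by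
  rw [← Subring.mem_center_iff.1 B.mem_center, Block.mul_idem]

/-- The identity element `e_B` of the block algebra. -/
def Block.one (B : Block O G) : B.alg := ⟨B.idem, 1, (one_mul _).symm⟩

/-- The map `B → B_Z` induced by `θ_Z`. -/
def Block.thetaAlg {Z : Subgroup G} [Z.Normal] {B : Block O G} {B' : Block O (G ⧸ Z)}
    (hB : B'.idem = theta O Z B.idem) : B.alg →ₗ[O] B'.alg where
  toFun x := ⟨theta O Z x, theta O Z x, by rw [hB, ← map_mul, Block.mul_idem]⟩
  map_add' x y := Subtype.ext (map_add (theta O Z) (x : O[G]) y)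
  map_smul' r x := Subtype.ext (map_smul (theta O Z) r (x : O[G]))

theorem Block.thetaAlg_surjective {Z : Subgroup G} [Z.Normal] {B : Block O G}
    {B' : Block O (G ⧸ Z)} (hB : B'.idem = theta O Z B.idem) :
    Function.Surjective (Block.thetaAlg hB) := by
  rintro ⟨_, a, rfl⟩
  obtain ⟨a, rfl⟩ := theta_surjective Z a
  exact ⟨⟨a * B.idem, a, rfl⟩, Subtype.ext <|
    (map_mul (theta O Z) a B.idem).trans (congrArg (theta O Z a * ·) hB.symm)⟩

theorem Block.thetaAlg_mul {Z : Subgroup G} [Z.Normal] {B : Block O G}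
    {B' : Block O (G ⧸ Z)} (hB : B'.idem = theta O Z B.idem) (x y : B.alg) :
    Block.thetaAlg hB (x * y) = Block.thetaAlg hB x * Block.thetaAlg hB y :=
  Subtype.ext (map_mul (theta O Z) (x : O[G]) y)

/-- Multiplication by the sum of the elements of `Z`, on a block algebra. -/
def Block.normMul [Finite G] (Z : Subgroup G) {B : Block O G} (x : B.alg) : B.alg :=
  ⟨normElement O Z * x, normElement O Z * x, by rw [mul_assoc, Block.mul_idem]⟩

end BlockAlgebra

section Reduction

variable {O : Type u} [CommRing O] [IsLocalRing O] {G : Type v} [Group G]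

theorem reduction_theta (Z : Subgroup G) [Z.Normal] (x : O[G]) :
    reduction (theta O Z x) = theta (IsLocalRing.ResidueField O) Z (reduction x) := by
  induction x using MonoidAlgebra.induction_linear with
  | zero => simp
  | add a b ha hb => simp only [map_add, ha, hb]
  | single g r => simp [theta_single, reduction]

theorem frobInv_theta {p : ℕ} [Fact p.Prime] [CharP (IsLocalRing.ResidueField O) p]
    [IsAlgClosed (IsLocalRing.ResidueField O)] (n : ℕ) (Z : Subgroup G) [Z.Normal]
    (x : (IsLocalRing.ResidueField O)[G]) :
    frobInv p n (theta (IsLocalRing.ResidueField O) Z x) =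
      theta (IsLocalRing.ResidueField O) Z (frobInv p n x) := by
  induction x using MonoidAlgebra.induction_linear with
  | zero => simp
  | add a b ha hb => simp only [map_add, ha, hb]
  | single g r => simp [theta_single, frobInv]

end Reduction

section StrongFrobenius

variable {p : ℕ} [Fact p.Prime] {O : Type u} [CommRing O] [IsDomain O] [IsLocalRing O]
  [CharP (IsLocalRing.ResidueField O) p] [IsAlgClosed (IsLocalRing.ResidueField O)]
  {G : Type v} [Group G]
  {n : ℕ} {B C : Block O G} {φ : B.alg ≃ₗ[O] C.alg}

theorem IsStrongFrobeniusIso.map_one (h : IsStrongFrobeniusIso (p := p) n B C φ) :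
    φ B.one = C.one := by
  obtain ⟨x, hx⟩ := φ.surjective C.one
  have h1 : φ B.one * φ x = φ x := by
    rw [← h.map_mul]
    exact congrArg φ (Subtype.ext (Block.idem_mul x))
  rw [hx] at h1
  exact (Subtype.ext (Block.mul_idem (φ B.one))).symm.trans h1

/-- The identity `ζ_G ^ n (e_B) = e_C`, which is the condition on the centre at the identity
element of `B`. -/
theorem IsStrongFrobeniusIso.zeta_iterate_idem (h : IsStrongFrobeniusIso (p := p) n B C φ) :
    (zeta O G p)^[n] B.idem = C.idem := by
  rw [← show ((φ B.one : C.alg) : O[G]) = C.idem from congrArg Subtype.val h.map_one]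
  refine (h.eq_zeta B.one fun b => Subtype.ext ?_).symm
  exact (Block.mul_idem b).trans (Block.idem_mul b).symm

variable [Finite G]

/-- The isomorphism `φ` commutes with multiplication by the sum of the elements of `Z`: that sum
times `e_B` is central, and `φ` is `ζ_G ^ n` on the centre, where `ζ_G` commutes with
multiplication by elements of `Z`. -/
theorem IsStrongFrobeniusIso.map_normMul (h : IsStrongFrobeniusIso (p := p) n B C φ)
    {Z : Subgroup G} (hZ : Z ≤ Subgroup.center G) (hpZ : IsPGroup p Z) (x : B.alg) :
    φ (Block.normMul Z x) = Block.normMul Z (φ x) := by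
  have hN := Subring.mem_center_iff.1 (normElement_mem_center (O := O) Z hZ)
  have h1 : ((φ (Block.normMul Z B.one) : C.alg) : O[G]) = normElement O Z * C.idem := by
    rw [h.eq_zeta, ← h.zeta_iterate_idem]
    · exact zeta_iterate_normElement_mul Fact.out Z hZ hpZ n B.idem
    · refine fun b => Subtype.ext ?_
      change (b : O[G]) * (normElement O Z * B.idem) = normElement O Z * B.idem * b
      rw [← mul_assoc, hN, mul_assoc, mul_assoc, Block.mul_idem, Block.idem_mul]
  have h2 : Block.normMul Z x = Block.normMul Z B.one * x := Subtype.ext <| by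
    change normElement O Z * (x : O[G]) = normElement O Z * B.idem * x
    rw [mul_assoc, Block.idem_mul]
  rw [h2, h.map_mul]
  refine Subtype.ext ?_
  change ((φ (Block.normMul Z B.one) : C.alg) : O[G]) * (φ x : O[G]) =
    normElement O Z * (φ x : O[G])
  rw [h1, mul_assoc, Block.idem_mul]

theorem IsStrongFrobeniusIso.theta_eq_zero_iff [CharZero O]
    (h : IsStrongFrobeniusIso (p := p) n B C φ) {Z : Subgroup G} [Z.Normal]
    (hZ : Z ≤ Subgroup.center G) (hpZ : IsPGroup p Z) (x : B.alg) :
    theta O Z (x : O[G]) = 0 ↔ theta O Z (φ x : O[G]) = 0 := by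
  rw [FrobeniusNumber.theta_eq_zero_iff Z hZ, FrobeniusNumber.theta_eq_zero_iff Z hZ]
  have h1 := h.map_normMul hZ hpZ x
  have h2 : φ (Block.normMul Z x) = 0 ↔ Block.normMul Z x = 0 := φ.map_eq_zero_iff
  rw [h1] at h2
  exact (Subtype.ext_iff.symm.trans h2.symm).trans Subtype.ext_iff

/-- A strong Frobenius isomorphism `B → B^{(p ^ n)}` induces one between the images of the blocks
in `O(G/Z)`. -/
theorem IsStrongFrobeniusIso.exists_quotient [CharZero O]
    (h : IsStrongFrobeniusIso (p := p) n B C φ) {Z : Subgroup G} [Z.Normal]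
    (hZ : Z ≤ Subgroup.center G) (hpZ : IsPGroup p Z) {B' C' : Block O (G ⧸ Z)}
    (hB : B'.idem = theta O Z B.idem) (hC : C'.idem = theta O Z C.idem) :
    ∃ ψ : B'.alg ≃ₗ[O] C'.alg, IsStrongFrobeniusIso (p := p) n B' C' ψ := by
  obtain ⟨ψ, hψ⟩ := exists_linearEquiv_of_surjective (Block.thetaAlg_surjective hB)
    (Block.thetaAlg_surjective hC) φ fun x => by
      rw [Subtype.ext_iff, Subtype.ext_iff]
      exact h.theta_eq_zero_iff hZ hpZ x
  have hψ' : ∀ x : B.alg, (ψ (Block.thetaAlg hB x) : O[G ⧸ Z]) = theta O Z (φ x : O[G]) :=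
    fun x => congrArg Subtype.val (hψ x)
  refine ⟨ψ, h.isTwist.of_idem_eq_theta hZ hB hC, ?_, ?_, ?_⟩
  · intro x y
    obtain ⟨x, rfl⟩ := Block.thetaAlg_surjective hB x
    obtain ⟨y, rfl⟩ := Block.thetaAlg_surjective hB y
    rw [← Block.thetaAlg_mul, hψ, hψ, hψ, h.map_mul, Block.thetaAlg_mul]
  · intro z hz
    obtain ⟨x, rfl⟩ := Block.thetaAlg_surjective hB z
    -- A central element of `B_Z` need not lift to a central element of `B`, but its multiple by
    -- the order of `Z` does: the product of any lift with the sum of the elements of `Z`.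
    have hcen : ∀ b : B.alg, b * Block.normMul Z x = Block.normMul Z x * b := by
      intro b
      refine Subtype.ext ?_
      change (b : O[G]) * (normElement O Z * x) = normElement O Z * x * b
      have hN := Subring.mem_center_iff.1 (normElement_mem_center (O := O) Z hZ)
      have hb := congrArg Subtype.val (hz (Block.thetaAlg hB b))
      have hb' : theta O Z ((b : O[G]) * x - x * b) = 0 := by
        rw [map_sub, _root_.map_mul, _root_.map_mul, sub_eq_zero]
        exact hb
      rw [FrobeniusNumber.theta_eq_zero_iff Z hZ, mul_sub, sub_eq_zero] at hb'
      rw [← mul_assoc, hN, mul_assoc, hb', mul_assoc]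
    refine natCard_smul_left_cancel Z ?_
    rw [hψ', ← theta_normElement_mul]
    have h1 : normElement O Z * (φ x : O[G]) =
        (zeta O G p)^[n] (normElement O Z * (x : O[G])) :=
      (congrArg Subtype.val (h.map_normMul hZ hpZ x)).symm.trans (h.eq_zeta _ hcen)
    rw [h1, zeta_iterate_normElement_mul Fact.out Z hZ hpZ, theta_normElement_mul,
      theta_zeta_iterate Fact.out]
    rfl
  · intro S _ _ _ hS
    -- Inflation of `S` along `kG → k(G/Z)` is a simple `B`-module.
    let θk : (IsLocalRing.ResidueField O)[G] →+* (IsLocalRing.ResidueField O)[G ⧸ Z] :=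
      (theta (IsLocalRing.ResidueField O) Z).toRingHom
    let := Module.compHom S θk
    have hsmul : ∀ (a : (IsLocalRing.ResidueField O)[G]) (s : S),
        a • s = theta (IsLocalRing.ResidueField O) Z a • s := fun _ _ => rfl
    have : IsSimpleModule (IsLocalRing.ResidueField O)[G] S := by
      rw [isSimpleModule_iff_toSpanSingleton_surjective]
      have hsimple : IsSimpleModule (IsLocalRing.ResidueField O)[G ⧸ Z] S := inferInstance
      refine ⟨hsimple.nontrivial, fun s hs t => ?_⟩
      obtain ⟨a, ha⟩ := IsSimpleModule.toSpanSingleton_surjective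
        (IsLocalRing.ResidueField O)[G ⧸ Z] hs t
      obtain ⟨a, rfl⟩ := theta_surjective Z a
      exact ⟨a, ha⟩
    obtain ⟨f, hf⟩ := h.simple S fun s => by
      rw [hsmul, ← reduction_theta, ← hB, hS]
    refine ⟨f, fun b s => ?_⟩
    obtain ⟨b, rfl⟩ := Block.thetaAlg_surjective hB b
    have hb := hf b s
    rw [hsmul, hsmul, ← frobInv_theta, ← reduction_theta, ← reduction_theta] at hb
    rw [hψ']
    exact hb

end StrongFrobenius

end FrobeniusNumber

end

theorem mainTheorem7 {p : ℕ} [Fact p.Prime]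
    {O : Type*} [CommRing O] [IsDomain O] [IsDiscreteValuationRing O] [CharZero O]
    [IsAdicComplete (IsLocalRing.maximalIdeal O) O]
    [CharP (IsLocalRing.ResidueField O) p] [IsAlgClosed (IsLocalRing.ResidueField O)]
    {G : Type*} [Group G] [Finite G]
    (Z : Subgroup G) [Z.Normal] (hZ : Z ≤ Subgroup.center G) (hpZ : IsPGroup p Z)
    (B : FrobeniusNumber.Block O G) :
    ∃ BZ : FrobeniusNumber.Block O (G ⧸ Z),
      BZ.idem = FrobeniusNumber.theta O Z B.idem ∧
      BZ.SOF p ≤ B.SOF p := by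
  refine ⟨B.quotient Z hZ hpZ, rfl, biInf_mono fun n => ?_⟩
  rintro ⟨hn, C, φ, hφ⟩
  exact ⟨hn, C.quotient Z hZ hpZ, hφ.exists_quotient hZ hpZ rfl rfl⟩
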